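/- **Theorem 2.4.** For $x,q$ in a field $K$ and $n\ge 0$ put $(x;q)_n=\prod_{i=0}^{n-1}(1-xq^i)$. A pair of sequences $(\alpha_n)_{n\ge0}$, $(\beta_n)_{n\ge0}$ in $K$ is called a Bailey pair with parameters $(a,q)$ if $$\beta_n=\sum_{r=0}^n\frac{\alpha_r}{(q;q)_{n-r}(aq;q)_{n+r}}\qquad\text{for all } n\ge 0 .$$ Let $K$ be a field (for example $\mathbb C$) and let $a,q\in K$ be nonzero with $q^{3m}\ne 1$ and $a^3q^{3m}\neq 1$ for all integers $m\ge 1$, so that no denominator below vanishes. If $(\alpha_n,\beta_n)$ is a Bailey pair with parameters $(a^3,q^3)$, then $(\alpha_n',\beta_n')$ is a Bailey pair with parameters $(a,q)$, where $$\alpha_r'=a^{-r}q^{-r^2}\alpha_r,$$ $$\beta_n'=\frac{1}{(aq;q)_{2n}}\sum_{k=0}^n\frac{(aq^{2n+1};q^{-1})_{3k}\,(a^3q^3;q^3)_{2(n-k)}}{(q^3;q^3)_k}(-1)^kq^{3\binom k2-n^2}a^{-n}\beta_{n-k}.\tag{T2}$$ Moreover, the map $(\alpha,\beta)\mapsto(\alpha',\beta')$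 on pairs of sequences in $K$ is the two-sided inverse of the map $(\alpha,\beta)\mapsto(\alpha'',\beta'')$ given by $$\alpha_r''=a^rq^{r^2}\alpha_r,\qquad \beta_n''=\frac{1}{(a^3q^3;q^3)_{2n}}\sum_{k=0}^n\frac{(aq;q)_{3n-k}\,a^kq^{k^2}}{(q^3;q^3)_{n-k}}\beta_k .\tag{T1}$$ -/

import Mathlib

/-- The `q`-shifted factorial `(x; q)_n = ∏_{i < n} (1 - x q ^ i)`. -/
def qPoch {K : Type*} [Field K] (x q : K) (n : ℕ) : K :=
  ∏ i ∈ Finset.range n, (1 - x * q ^ i)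

/-- `(α, β)` is a Bailey pair with parameters `(a, q)`:
`β_n = ∑_{r ≤ n} α_r / ((q; q)_{n-r} (a q; q)_{n+r})` for all `n ≥ 0`. -/
def IsBaileyPair {K : Type*} [Field K] (a q : K) (α β : ℕ → K) : Prop :=
  ∀ n : ℕ, β n = ∑ r ∈ Finset.range (n + 1),
    α r / (qPoch q q (n - r) * qPoch (a * q) q (n + r))

/-- The upward change of base on `α`: `α'_r = a^r q^{r^2} α_r`. -/
def cubeUpAlpha {K : Type*} [Field K] (a q : K) (α : ℕ → K) (r : ℕ) : K :=
  a ^ r * q ^ (r ^ 2) * α r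

/-- The upward change of base on `β` (from base `q` to base `q ^ 3`):
`β'_n = 1 / (a^3 q^3; q^3)_{2n} ∑_{k ≤ n} (a q; q)_{3n-k} a^k q^{k^2} / (q^3; q^3)_{n-k} β_k`. -/
def cubeUpBeta {K : Type*} [Field K] (a q : K) (β : ℕ → K) (n : ℕ) : K :=
  1 / qPoch (a ^ 3 * q ^ 3) (q ^ 3) (2 * n) *
    ∑ k ∈ Finset.range (n + 1),
      qPoch (a * q) q (3 * n - k) * a ^ k * q ^ (k ^ 2) /
        qPoch (q ^ 3) (q ^ 3) (n - k) * β k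

/-- The downward change of base on `α`: `α'_r = a^{-r} q^{-r^2} α_r`. -/
def cubeDownAlpha {K : Type*} [Field K] (a q : K) (α : ℕ → K) (r : ℕ) : K :=
  a ^ (-(r : ℤ)) * q ^ (-((r : ℤ) ^ 2)) * α r

/-- The downward change of base on `β` (from base `q ^ 3` to base `q`):
`β'_n = 1 / (a q; q)_{2n} ∑_{k ≤ n} (a q^{2n+1}; q^{-1})_{3k} (a^3 q^3; q^3)_{2(n-k)}
/ (q^3; q^3)_k (-1)^k q^{3 binom(k,2) - n^2} a^{-n} β_{n-k}`. -/
def cubeDownBeta {K : Type*} [Field K] (a q : K) (β : ℕ → K) (n : ℕ) : K :=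
  1 / qPoch (a * q) q (2 * n) *
    ∑ k ∈ Finset.range (n + 1),
      qPoch (a * q ^ (2 * n + 1)) q⁻¹ (3 * k) *
          qPoch (a ^ 3 * q ^ 3) (q ^ 3) (2 * (n - k)) /
        qPoch (q ^ 3) (q ^ 3) k *
      (-1) ^ k * q ^ (3 * (k.choose 2 : ℤ) - (n : ℤ) ^ 2) * a ^ (-(n : ℤ)) * β (n - k)

/-! The upward map is handled first and the downward map is deduced by inversion. Inserting the
Bailey relation into (T1) and exchanging sums leaves, as coefficient of each `α r`, a cubic sum. It
is a `q`-Pfaff–Saalschütz sum with two parameters `ω q^{-n}`, `ω² q^{-n}`, where `ω` is a root of `1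
+ x + x²` (`sum_cubic`), so (T1) preserves Bailey pairs. On `β`, down after up is the identity
because off-diagonal coefficients are `q³`-binomial sums of polynomials of too low degree
(`cubeDownBeta_cubeUpBeta`). The downward map is triangular, hence injective, so this left inverse
is two-sided. The Bailey relation for (T2) then follows by lifting the pair generated by `α'` and
inverting. -/

theorem qPoch_zero {K : Type*} [Field K] (x q : K) : qPoch x q 0 = 1 := by
  simp [qPoch]

theorem qPoch_succ {K : Type*} [Field K] (x q : K) (n : ℕ) :
    qPoch x q (n + 1) = qPoch x q n * (1 - x * q ^ n) := by
  simp [qPoch, Finset.prod_range_succ]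

theorem qPoch_add {K : Type*} [Field K] (x q : K) (m n : ℕ) :
    qPoch x q (m + n) = qPoch x q m * qPoch (x * q ^ m) q n := by
  simp only [qPoch, Finset.prod_range_add, pow_add, mul_assoc]

theorem qPoch_succ' {K : Type*} [Field K] (x q : K) (n : ℕ) :
    qPoch x q (n + 1) = (1 - x) * qPoch (x * q) q n := by
  rw [add_comm, qPoch_add]; simp [qPoch]

theorem qPoch_ne_zero {K : Type*} [Field K] {x q : K} (n : ℕ)
    (h : ∀ i < n, x * q ^ i ≠ 1) : qPoch x q n ≠ 0 :=
  Finset.prod_ne_zero_iff.2 fun i hi => sub_ne_zero.2 (h i (Finset.mem_range.1 hi)).symm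

theorem qPoch_self_ne_zero {K : Type*} [Field K] {q : K} (h : ∀ m : ℕ, 1 ≤ m → q ^ m ≠ 1)
    (n : ℕ) : qPoch q q n ≠ 0 :=
  qPoch_ne_zero n fun i _ => by rw [← pow_succ']; exact h _ (by omega)

theorem qPoch_mul_self_ne_zero {K : Type*} [Field K] {a q : K}
    (h : ∀ m : ℕ, 1 ≤ m → a * q ^ m ≠ 1) (n : ℕ) : qPoch (a * q) q n ≠ 0 :=
  qPoch_ne_zero n fun i _ => by rw [mul_assoc, ← pow_succ']; exact h _ (by omega)

theorem qPoch_inv_base {K : Type*} [Field K] {q : K} (hq : q ≠ 0) (y : K) (s : ℕ) :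
    qPoch (y * q ^ s) q⁻¹ s = qPoch (y * q) q s := by
  unfold qPoch
  rw [← Finset.prod_range_reflect]
  refine Finset.prod_congr rfl fun i hi => ?_
  obtain ⟨t, rfl⟩ : ∃ t, s = i + 1 + t := Nat.exists_eq_add_of_le (Finset.mem_range.1 hi)
  have : i + 1 + t - 1 - i = t := by omega
  rw [this, inv_pow]
  congr 1
  field_simp
  ring

/-! ### Finite `q`-binomial sums -/

/-- The finite `q`-binomial theorem. -/
theorem sum_qBinomial {K : Type*} [Field K] {q : K} (h : ∀ m : ℕ, 1 ≤ m → q ^ m ≠ 1) (z : K)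
    (n : ℕ) :
    ∑ k ∈ Finset.range (n + 1),
      (-1) ^ k * q ^ (k.choose 2) * z ^ k / (qPoch q q k * qPoch q q (n - k)) =
      qPoch z q n / qPoch q q n := by
  have hP := qPoch_self_ne_zero h
  have h1 : ∀ m : ℕ, 1 - q * q ^ m ≠ 0 := fun m => by
    rw [← pow_succ']; exact sub_ne_zero.2 (h _ (by omega)).symm
  induction n with
  | zero => simp [qPoch]
  | succ n ih =>
    -- Telescoping certificate: partial sums of the recurrence in `n` have closed form, and at `m =
    -- n` this cancels the leftover term `k = n + 1`.
    have key : ∀ m ≤ n, ∑ k ∈ Finset.range (m + 1),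
        ((1 - q * q ^ n) * ((-1) ^ k * q ^ (k.choose 2) * z ^ k /
            (qPoch q q k * qPoch q q (n + 1 - k))) -
          (1 - z * q ^ n) * ((-1) ^ k * q ^ (k.choose 2) * z ^ k /
            (qPoch q q k * qPoch q q (n - k)))) =
        q ^ n * z * ((-1) ^ m * q ^ (m.choose 2) * z ^ m /
          (qPoch q q m * qPoch q q (n - m))) := by
      intro m
      induction m with
      | zero =>
        intro _
        have := hP n
        have hn := h1 n
        simp only [Finset.sum_range_succ, Finset.sum_range_zero, qPoch_zero, qPoch_succ, tsub_zero,
          pow_zero, Nat.choose_zero_succ]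
        generalize q ^ n = y at hn ⊢
        field_simp
        ring
      | succ m ihm =>
        intro hm
        rw [Finset.sum_range_succ, ihm (by omega)]
        obtain ⟨k, rfl⟩ : ∃ k, n = m + 1 + k := Nat.exists_eq_add_of_le hm
        have e1 : m + 1 + k + 1 - (m + 1) = k + 1 := by omega
        have e2 : m + 1 + k - (m + 1) = k := by omega
        have e3 : m + 1 + k - m = k + 1 := by omega
        have e4 : (m + 1).choose 2 = m.choose 2 + m := by
          rw [Nat.choose_succ_succ' m 1]; simp [add_comm]
        rw [e1, e2, e3, e4]
        simp only [qPoch_succ]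
        have := hP m
        have := hP k
        have hm := h1 m
        have hk := h1 k
        simp only [pow_add, pow_one]
        generalize q ^ m = x at hm ⊢
        generalize q ^ k = y at hk ⊢
        have hm' := hm
        have hk' := hk
        rw [mul_comm] at hm' hk'
        field_simp
        ring
    have hk := key n le_rfl
    rw [Finset.sum_sub_distrib, ← Finset.mul_sum, ← Finset.mul_sum, ih] at hk
    have e4 : (n + 1).choose 2 = n.choose 2 + n := by
      rw [Nat.choose_succ_succ' n 1]; simp [add_comm]
    have hn := hP n
    have hn1 := h1 n
    rw [Finset.sum_range_succ]
    refine mul_left_cancel₀ hn1 ?_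
    rw [mul_add, sub_eq_iff_eq_add.1 hk]
    simp only [Nat.sub_self, qPoch_zero, qPoch_succ, e4, pow_add, pow_one]
    generalize q ^ n = y at hn1 ⊢
    have hn1' := hn1
    rw [mul_comm] at hn1'
    field_simp
    ring

/-- `q`-binomial sums of length `n` annihilate polynomials in `q ^ j` of degree less than `n`. -/
theorem sum_qBinomial_eval_eq_zero {K : Type*} [Field K] {q : K} (hq : q ≠ 0)
    (h : ∀ m : ℕ, 1 ≤ m → q ^ m ≠ 1) {n : ℕ} (g : Polynomial K) (hg : g.natDegree < n) :
    ∑ j ∈ Finset.range (n + 1),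
      (-1) ^ (n - j) * q ^ ((n - j).choose 2) / (qPoch q q (n - j) * qPoch q q j) *
        g.eval (q ^ j) = 0 := by
  rw [← Finset.sum_range_reflect]
  have : ∀ k ∈ Finset.range (n + 1),
      (-1) ^ (n - (n + 1 - 1 - k)) * q ^ ((n - (n + 1 - 1 - k)).choose 2) /
        (qPoch q q (n - (n + 1 - 1 - k)) * qPoch q q (n + 1 - 1 - k)) *
        g.eval (q ^ (n + 1 - 1 - k)) =
      ∑ i ∈ Finset.range n, g.coeff i * (q ^ n) ^ i *
        ((-1) ^ k * q ^ (k.choose 2) * ((q ^ i)⁻¹) ^ k / (qPoch q q k * qPoch q q (n - k))) := by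
    intro k hk
    obtain ⟨t, rfl⟩ := Nat.exists_eq_add_of_le (Nat.lt_succ_iff.1 (Finset.mem_range.1 hk))
    have e1 : k + t + 1 - 1 - k = t := by omega
    have e2 : k + t - t = k := by omega
    have e3 : k + t - k = t := by omega
    rw [e1, e2, e3, Polynomial.eval_eq_sum_range' hg, Finset.mul_sum]
    refine Finset.sum_congr rfl fun i _ => ?_
    have : (q ^ (k + t)) ^ i * ((q ^ i)⁻¹) ^ k = (q ^ t) ^ i := by
      rw [inv_pow, pow_add, mul_pow, pow_right_comm q k i]
      field_simp
    rw [← this]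
    ring
  rw [Finset.sum_congr rfl this, Finset.sum_comm]
  refine Finset.sum_eq_zero fun i hi => ?_
  rw [← Finset.mul_sum, sum_qBinomial h]
  -- The monomial of degree `i < n` corresponds to `z = q^{-i}`, a zero of `(z; q)_n`.
  have : qPoch (q ^ i)⁻¹ q n = 0 :=
    Finset.prod_eq_zero hi (by rw [inv_mul_cancel₀ (pow_ne_zero _ hq), sub_self])
  simp [this]

/-! ### The Saalschütz sum and its cubic case -/

/-- The `q`-Pfaff–Saalschütz sum, with the two free numerator parameters given by their sum `s`
and product `p`. -/
theorem sum_qSaalschutz {K : Type*} [Field K] {q : K}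
    (h : ∀ m : ℕ, 1 ≤ m → q ^ m ≠ 1) (s p d : K) (n : ℕ) :
    ∑ j ∈ Finset.range (n + 1),
      (∏ i ∈ Finset.range j, (1 - s * q ^ i + p * q ^ (2 * i))) * qPoch d q (n - j) * d ^ j *
        qPoch (d * p * q ^ j) q (n - j) / (qPoch q q j * qPoch q q (n - j)) =
      (∏ i ∈ Finset.range n, (1 - d * s * q ^ i + d ^ 2 * p * q ^ (2 * i))) / qPoch q q n := by
  have hP := qPoch_self_ne_zero h
  have h1 : ∀ m : ℕ, 1 - q * q ^ m ≠ 0 := fun m => by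
    rw [← pow_succ']; exact sub_ne_zero.2 (h _ (by omega)).symm
  induction n with
  | zero => simp [qPoch]
  | succ n ih =>
    have key : ∀ m ≤ n, ∑ j ∈ Finset.range (m + 1),
        ((1 - q * q ^ n) * ((∏ i ∈ Finset.range j, (1 - s * q ^ i + p * q ^ (2 * i))) *
            qPoch d q (n + 1 - j) * d ^ j * qPoch (d * p * q ^ j) q (n + 1 - j) /
            (qPoch q q j * qPoch q q (n + 1 - j))) -
          (1 - d * s * q ^ n + d ^ 2 * p * q ^ (2 * n)) *
            ((∏ i ∈ Finset.range j, (1 - s * q ^ i + p * q ^ (2 * i))) *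
            qPoch d q (n - j) * d ^ j * qPoch (d * p * q ^ j) q (n - j) /
            (qPoch q q j * qPoch q q (n - j)))) =
        -(q ^ (n - m) * d * ((∏ i ∈ Finset.range (m + 1), (1 - s * q ^ i + p * q ^ (2 * i))) *
            qPoch d q (n - m) * d ^ m * qPoch (d * p * q ^ m) q (n - m) /
            (qPoch q q m * qPoch q q (n - m)))) := by
      intro m
      induction m with
      | zero =>
        intro _
        have := hP n
        have hn := h1 n
        simp only [Finset.sum_range_succ, Finset.sum_range_zero, Finset.prod_range_succ,
          Finset.prod_range_zero, qPoch_zero, qPoch_succ, tsub_zero, pow_zero, mul_zero,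
          pow_mul' q 2 n]
        generalize q ^ n = y at hn ⊢
        field_simp
        ring
      | succ m ihm =>
        intro hm
        rw [Finset.sum_range_succ, ihm (by omega)]
        obtain ⟨k, rfl⟩ : ∃ k, n = m + 1 + k := Nat.exists_eq_add_of_le hm
        have e1 : m + 1 + k + 1 - (m + 1) = k + 1 := by omega
        have e2 : m + 1 + k - (m + 1) = k := by omega
        have e3 : m + 1 + k - m = k + 1 := by omega
        rw [e1, e2, e3, Finset.prod_range_succ _ (m + 1), qPoch_succ' (d * p * q ^ m),
          mul_assoc (d * p) (q ^ m) q, ← pow_succ]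
        generalize ∏ i ∈ Finset.range (m + 1), (1 - s * q ^ i + p * q ^ (2 * i)) = W
        simp only [qPoch_succ]
        generalize qPoch (d * p * q ^ (m + 1)) q k = V
        have := hP m
        have := hP k
        have hm := h1 m
        have hk := h1 k
        simp only [pow_add, mul_comm 2, pow_mul, pow_one]
        generalize q ^ m = x at hm ⊢
        generalize q ^ k = y at hk ⊢
        have hm' := hm
        have hk' := hk
        rw [mul_comm] at hm' hk'
        field_simp
        ring
    have hk := key n le_rfl
    rw [Finset.sum_sub_distrib, ← Finset.mul_sum, ← Finset.mul_sum, ih] at hk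
    have hn := hP n
    have hn1 := h1 n
    rw [Finset.sum_range_succ]
    refine mul_left_cancel₀ hn1 ?_
    rw [mul_add, sub_eq_iff_eq_add.1 hk]
    simp only [Finset.prod_range_succ _ n, Nat.sub_self, qPoch_zero, qPoch_succ, pow_zero, pow_mul' q 2 n,
      pow_add, pow_one]
    generalize q ^ n = y at hn1 ⊢
    have hn1' := hn1
    rw [mul_comm] at hn1'
    field_simp
    ring

theorem qPoch_mul_prod_cyclotomic {K : Type*} [Field K] (x q : K) (n : ℕ) :
    qPoch x q n * ∏ i ∈ Finset.range n, (1 + x * q ^ i + x ^ 2 * q ^ (2 * i)) =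
      qPoch (x ^ 3) (q ^ 3) n := by
  unfold qPoch
  rw [← Finset.prod_mul_distrib]
  exact Finset.prod_congr rfl fun i _ => by ring

/-- `∏_{i < j} (1 + q^{i-n} + q^{2(i-n)})` in terms of shifted factorials, for `n = j + k`. -/
theorem prod_cyclotomic_neg {K : Type*} [Field K] {q : K} (hq : q ≠ 0) (j k : ℕ) :
    (∏ i ∈ Finset.range j,
      (1 + (q ^ (j + k))⁻¹ * q ^ i + ((q ^ (j + k))⁻¹) ^ 2 * q ^ (2 * i))) *
      (qPoch q q (j + k) * qPoch (q ^ 3) (q ^ 3) k) * q ^ (2 * k * j + j ^ 2 + j) =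
      qPoch (q ^ 3) (q ^ 3) (j + k) * qPoch q q k := by
  -- Reversing the product removes `j` from the factors, which makes induction on `j` possible.
  have hrefl : (∏ i ∈ Finset.range j,
      (1 + (q ^ (j + k))⁻¹ * q ^ i + ((q ^ (j + k))⁻¹) ^ 2 * q ^ (2 * i))) =
      ∏ i ∈ Finset.range j, (1 + (q ^ (k + 1 + i))⁻¹ + ((q ^ (k + 1 + i))⁻¹) ^ 2) := by
    rw [← Finset.prod_range_reflect]
    refine Finset.prod_congr rfl fun i hi => ?_
    obtain ⟨t, rfl⟩ : ∃ t, j = i + 1 + t := Nat.exists_eq_add_of_le (Finset.mem_range.1 hi)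
    have : i + 1 + t - 1 - i = t := by omega
    have e : (q ^ (i + 1 + t + k))⁻¹ * q ^ t = (q ^ (k + 1 + i))⁻¹ := by
      rw [show i + 1 + t + k = (k + 1 + i) + t by omega, pow_add q (k + 1 + i) t]
      field_simp
    rw [this, ← e]
    ring
  rw [hrefl]
  clear hrefl
  induction j with
  | zero => simp [mul_comm]
  | succ j ih =>
    rw [Finset.prod_range_succ, show j + 1 + k = j + k + 1 by omega, qPoch_succ, qPoch_succ _ _ (j + k),
      show 2 * k * (j + 1) + (j + 1) ^ 2 + (j + 1) =
        (2 * k * j + j ^ 2 + j) + 2 * (k + 1 + j) by ring, pow_add q (2 * k * j + j ^ 2 + j)]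
    have e : (1 + (q ^ (k + 1 + j))⁻¹ + ((q ^ (k + 1 + j))⁻¹) ^ 2) * (1 - q * q ^ (j + k)) *
        q ^ (2 * (k + 1 + j)) = 1 - q ^ 3 * (q ^ 3) ^ (j + k) := by
      field_simp
      ring
    rw [← e]
    linear_combination (1 + (q ^ (k + 1 + j))⁻¹ + ((q ^ (k + 1 + j))⁻¹) ^ 2) *
      (1 - q * q ^ (j + k)) * q ^ (2 * (k + 1 + j)) * ih

/-- The cubic specialisation of the `q`-Pfaff–Saalschütz sum. -/
theorem sum_cubic {K : Type*} [Field K] {q : K} (hq : q ≠ 0)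
    (h : ∀ m : ℕ, 1 ≤ m → (q ^ 3) ^ m ≠ 1) (A : K)
    (hA : ∀ m : ℕ, 1 ≤ m → A ^ 3 * (q ^ 3) ^ m ≠ 1) (n : ℕ) :
    ∑ j ∈ Finset.range (n + 1),
      qPoch (A * q) q (3 * n - j) * A ^ j * q ^ (j ^ 2) /
        (qPoch (q ^ 3) (q ^ 3) (n - j) * (qPoch q q j * qPoch (A * q) q j)) =
      qPoch (A ^ 3 * q ^ 3) (q ^ 3) (2 * n) /
        (qPoch (q ^ 3) (q ^ 3) n * qPoch (A ^ 3 * q ^ 3) (q ^ 3) n) := by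
  have h' : ∀ m : ℕ, 1 ≤ m → q ^ m ≠ 1 := fun m hm hm1 =>
    h m hm (by rw [pow_right_comm, hm1, one_pow])
  have hA' : ∀ m : ℕ, 1 ≤ m → A * q ^ m ≠ 1 := fun m hm hm1 =>
    h' m hm <| absurd (by rw [pow_right_comm, ← mul_pow, hm1, one_pow]) (hA m hm)
  have hP := qPoch_self_ne_zero h'
  have hP3 := qPoch_self_ne_zero h
  have hQ := qPoch_mul_self_ne_zero hA'
  have hQ3 := qPoch_mul_self_ne_zero hA
  -- With this sum and product the factors are `1 + x + x²` at `x = q^{i-n}`, without requiring `ω ∈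
  -- K`; `d` is chosen so that `d p = A q`.
  have key := sum_qSaalschutz h' (-(q ^ n)⁻¹) (((q ^ n)⁻¹) ^ 2) (A * q ^ (2 * n + 1)) n
  have hd : ∀ k, qPoch (A * q) q (2 * n + k) =
      qPoch (A * q) q (2 * n) * qPoch (A * q ^ (2 * n + 1)) q k := fun k => by
    rw [qPoch_add, mul_assoc A q, ← pow_succ']
  have hc : A * q ^ (2 * n + 1) * ((q ^ n)⁻¹) ^ 2 = A * q := by
    rw [pow_succ, mul_comm 2 n, pow_mul]
    field_simp
  have hr : ∏ i ∈ Finset.range n, (1 - A * q ^ (2 * n + 1) * (-(q ^ n)⁻¹) * q ^ i +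
      (A * q ^ (2 * n + 1)) ^ 2 * ((q ^ n)⁻¹) ^ 2 * q ^ (2 * i)) =
      qPoch (A ^ 3 * q ^ 3) (q ^ 3) (2 * n) * qPoch (A * q) q n /
        (qPoch (A ^ 3 * q ^ 3) (q ^ 3) n * qPoch (A * q) q (2 * n)) := by
    rw [eq_div_iff (mul_ne_zero (hQ3 _) (hQ _)), two_mul n, qPoch_add, qPoch_add, ← two_mul]
    have := qPoch_mul_prod_cyclotomic (A * q * q ^ n) q n
    rw [show A ^ 3 * q ^ 3 * (q ^ 3) ^ n = (A * q * q ^ n) ^ 3 by ring, ← this]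
    have e : ∀ i, 1 - A * q ^ (2 * n + 1) * (-(q ^ n)⁻¹) * q ^ i +
        (A * q ^ (2 * n + 1)) ^ 2 * ((q ^ n)⁻¹) ^ 2 * q ^ (2 * i) =
        1 + A * q * q ^ n * q ^ i + (A * q * q ^ n) ^ 2 * q ^ (2 * i) := fun i => by
      rw [pow_succ, mul_comm 2 n, pow_mul]
      field_simp
      ring
    simp only [e]
    ring
  rw [hr] at key
  have hne : qPoch (q ^ 3) (q ^ 3) n * qPoch (A * q) q n / qPoch (A * q) q (2 * n) / qPoch q q n ≠ 0 :=
    div_ne_zero (div_ne_zero (mul_ne_zero (hP3 _) (hQ _)) (hQ _)) (hP _)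
  refine mul_left_cancel₀ hne ?_
  trans qPoch (A ^ 3 * q ^ 3) (q ^ 3) (2 * n) * qPoch (A * q) q n /
        (qPoch (A ^ 3 * q ^ 3) (q ^ 3) n * qPoch (A * q) q (2 * n)) / qPoch q q n
  swap
  · have := hP3 n
    field_simp
  rw [← key, Finset.mul_sum]
  refine Finset.sum_congr rfl fun j hj => ?_
  obtain ⟨k, rfl⟩ := Nat.exists_eq_add_of_le (Nat.lt_succ_iff.1 (Finset.mem_range.1 hj))
  have e1 : 3 * (j + k) - j = 2 * (j + k) + k := by omega
  rw [hc, Nat.add_sub_cancel_left, e1, hd, qPoch_add (A * q) q j k]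
  have hW := prod_cyclotomic_neg hq j k
  simp only [sub_neg_eq_add, neg_mul]
  rw [← eq_div_iff (pow_ne_zero _ hq), ← eq_div_iff (mul_ne_zero (hP _) (hP3 _))] at hW
  rw [hW]
  have := hP (j + k)
  have := hP k
  have := hP j
  have := hP3 k
  have := hP3 (j + k)
  have := hQ j
  have := hQ (2 * (j + k))
  have e2 : (A * q ^ (2 * (j + k) + 1)) ^ j = A ^ j * q ^ j ^ 2 * q ^ (2 * k * j + j ^ 2 + j) := by
    rw [mul_pow, ← pow_mul, mul_assoc, ← pow_add]
    congr 2
    ring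
  rw [e2]
  generalize qPoch (A * q) q j = u at *
  generalize qPoch (A * q) q (2 * (j + k)) = v at *
  field_simp

/-! ### Lifting Bailey pairs to base `q³` -/

theorem isBaileyPair_cubeUp {K : Type*} [Field K] {a q : K} (hq : q ≠ 0)
    (h : ∀ m : ℕ, 1 ≤ m → (q ^ 3) ^ m ≠ 1) (ha3 : ∀ m : ℕ, 1 ≤ m → a ^ 3 * (q ^ 3) ^ m ≠ 1)
    {α β : ℕ → K} (hab : IsBaileyPair a q α β) :
    IsBaileyPair (a ^ 3) (q ^ 3) (cubeUpAlpha a q α) (cubeUpBeta a q β) := by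
  intro n
  have hP3 := qPoch_self_ne_zero h
  have hQ3 := qPoch_mul_self_ne_zero ha3
  have h' : ∀ m : ℕ, 1 ≤ m → a * q ^ m ≠ 1 := fun m hm hm1 =>
    ha3 m hm (by rw [pow_right_comm, ← mul_pow, hm1, one_pow])
  have hQ := qPoch_mul_self_ne_zero h'
  unfold cubeUpBeta cubeUpAlpha
  simp only [hab _, Finset.mul_sum]
  rw [Finset.range_eq_Ico]
  simp only [Finset.range_eq_Ico]
  rw [Finset.sum_comm' (t' := Finset.Ico 0 (n + 1)) (s' := fun r => Finset.Ico r (n + 1))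
    (by intro x y; simp only [Finset.mem_Ico]; omega)]
  refine Finset.sum_congr rfl fun r hr => ?_
  obtain ⟨N, rfl⟩ := Nat.exists_eq_add_of_le (Nat.lt_succ_iff.1 (Finset.mem_Ico.1 hr).2)
  rw [Finset.sum_Ico_eq_sum_range, show r + N + 1 - r = N + 1 by omega]
  -- Shifting the summation by `r` replaces `a` by `a q^{2r}` and `n` by `N = n - r`.
  have hc := sum_cubic hq h (a * q ^ (2 * r)) (fun m hm => by
    have := ha3 (m + 2 * r) (by omega)
    convert this using 1
    ring) N
  have hadd : ∀ k, qPoch (a * q) q (2 * r + k) =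
      qPoch (a * q) q (2 * r) * qPoch (a * q ^ (2 * r) * q) q k := fun k => by
    rw [qPoch_add, mul_right_comm a]
  have hadd3 : ∀ k, qPoch (a ^ 3 * q ^ 3) (q ^ 3) (2 * r + k) =
      qPoch (a ^ 3 * q ^ 3) (q ^ 3) (2 * r) *
        qPoch ((a * q ^ (2 * r)) ^ 3 * q ^ 3) (q ^ 3) k := fun k => by
    rw [qPoch_add]; congr 2; ring
  have hQr := hQ (2 * r)
  have e := hadd3 (2 * N)
  have e' := hadd3 N
  rw [show 2 * r + 2 * N = 2 * (r + N) by ring] at e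
  rw [show 2 * r + N = r + N + r by ring] at e'
  have n1 := hQ3 (2 * (r + N))
  have n2 := hQ3 (r + N + r)
  rw [e] at n1
  rw [e'] at n2
  rw [e, e', Nat.add_sub_cancel_left]
  trans a ^ r * q ^ r ^ 2 * α r / qPoch (a ^ 3 * q ^ 3) (q ^ 3) (2 * r) /
    qPoch ((a * q ^ (2 * r)) ^ 3 * q ^ 3) (q ^ 3) (2 * N) *
    (qPoch ((a * q ^ (2 * r)) ^ 3 * q ^ 3) (q ^ 3) (2 * N) /
        (qPoch (q ^ 3) (q ^ 3) N * qPoch ((a * q ^ (2 * r)) ^ 3 * q ^ 3) (q ^ 3) N))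
  · rw [← hc, Finset.mul_sum]
    refine Finset.sum_congr rfl fun j hj => ?_
    obtain ⟨k, rfl⟩ := Nat.exists_eq_add_of_le (Nat.lt_succ_iff.1 (Finset.mem_range.1 hj))
    have e1 : 3 * (r + (j + k)) - (r + j) = 2 * r + (3 * (j + k) - j) := by omega
    have e2 : r + j + r = 2 * r + j := by ring
    have e3 : r + (j + k) - (r + j) = k := by omega
    have e4 : a ^ (r + j) * q ^ (r + j) ^ 2 =
        a ^ r * q ^ r ^ 2 * ((a * q ^ (2 * r)) ^ j * q ^ j ^ 2) := by ring
    rw [e1, e2, e3, hadd, hadd, Nat.add_sub_cancel_left, Nat.add_sub_cancel_left,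
      mul_assoc _ (a ^ (r + j)), e4]
    field_simp
  · have := left_ne_zero_of_mul n1
    have := right_ne_zero_of_mul n1
    generalize qPoch ((a * q ^ (2 * r)) ^ 3 * q ^ 3) (q ^ 3) (2 * N) = u at *
    field_simp

/-! ### Inversion -/

/-- The factors `1 - a q^e` run over `1 ≤ e ≤ 3j-m` and `3j-n+2 ≤ e ≤ 2n+1`; exchanging the upper
ends of the two runs isolates the dependence on `j` in a polynomial in `(q³)^j` of degree at most
`n-m-1`. -/
theorem qPoch_mul_qPoch_inv_base {K : Type*} [Field K] {q : K} (hq : q ≠ 0) (a : K) {m j n : ℕ}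
    (hmj : m ≤ j) (hjn : j ≤ n) (hmn : m < n) :
    qPoch (a * q) q (3 * j - m) * qPoch (a * q ^ (2 * n + 1)) q⁻¹ (3 * (n - j)) =
      qPoch (a * q) q (2 * n + 1) * qPoch (a / q ^ n * q ^ 2 * (q ^ 3) ^ j) q (n - m - 1) := by
  have hrev : qPoch (a * q ^ (2 * n + 1)) q⁻¹ (3 * (n - j)) =
      qPoch (a / q ^ n * q ^ 2 * (q ^ 3) ^ j) q (3 * (n - j)) := by
    obtain ⟨k, rfl⟩ := Nat.exists_eq_add_of_le hjn
    have : a * q ^ (2 * (j + k) + 1) = (a / q ^ (j + k) * q ^ (3 * j + 1)) * q ^ (3 * k) := by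
      field_simp
      ring
    rw [Nat.add_sub_cancel_left, this, qPoch_inv_base hq]
    congr 1
    ring
  rw [hrev]
  -- The cases are whether the second run starts at or above exponent `1`, or at or below it.
  rcases le_total n (3 * j + 1) with hn | hn
  · obtain ⟨δ, hδ⟩ := Nat.exists_eq_add_of_le hn
    have e : a / q ^ n * q ^ 2 * (q ^ 3) ^ j = a * q * q ^ δ := by
      rw [← pow_mul, mul_assoc, ← pow_add, show 2 + 3 * j = n + (1 + δ) by omega, pow_add, pow_add]
      field_simp
    rw [e, show 3 * j - m = δ + (n - m - 1) by omega, show 2 * n + 1 = δ + 3 * (n - j) by omega,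
      qPoch_add, qPoch_add]
    ring
  · obtain ⟨δ, hδ⟩ := Nat.exists_eq_add_of_le hn
    have e : a / q ^ n * q ^ 2 * (q ^ 3) ^ j * q ^ δ = a * q := by
      rw [← pow_mul, mul_assoc, mul_assoc, ← pow_add, ← pow_add,
        show 2 + (3 * j + δ) = n + 1 by omega, pow_add]
      field_simp
    rw [show 3 * (n - j) = δ + (2 * n + 1) by omega, show n - m - 1 = δ + (3 * j - m) by omega,
      qPoch_add _ q δ, qPoch_add _ q δ, e]
    ring

/-- `(b y; q)_d` is a polynomial in `y` of degree at most `d`. -/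
theorem exists_polynomial_qPoch {K : Type*} [Field K] (b q : K) (d : ℕ) :
    ∃ g : Polynomial K, g.natDegree ≤ d ∧ ∀ y, g.eval y = qPoch (b * y) q d := by
  refine ⟨∏ i ∈ Finset.range d, (1 - Polynomial.C (b * q ^ i) * Polynomial.X), ?_, fun y => ?_⟩
  · refine (Polynomial.natDegree_prod_le _ _).trans ?_
    refine (Finset.sum_le_card_nsmul _ _ 1 fun i _ => ?_).trans (by simp)
    compute_degree
  · simp only [Polynomial.eval_prod, qPoch, Polynomial.eval_sub, Polynomial.eval_one,
      Polynomial.eval_mul, Polynomial.eval_C, Polynomial.eval_X]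
    exact Finset.prod_congr rfl fun i _ => by ring

theorem cubeDownBeta_cubeUpBeta {K : Type*} [Field K] {a q : K} (ha : a ≠ 0) (hq : q ≠ 0)
    (h : ∀ m : ℕ, 1 ≤ m → (q ^ 3) ^ m ≠ 1) (ha3 : ∀ m : ℕ, 1 ≤ m → a ^ 3 * (q ^ 3) ^ m ≠ 1)
    (β : ℕ → K) : cubeDownBeta a q (cubeUpBeta a q β) = β := by
  have hP3 := qPoch_self_ne_zero h
  have hQ3 := qPoch_mul_self_ne_zero ha3
  have h' : ∀ m : ℕ, 1 ≤ m → a * q ^ m ≠ 1 := fun m hm hm1 =>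
    ha3 m hm (by rw [pow_right_comm, ← mul_pow, hm1, one_pow])
  have hQ := qPoch_mul_self_ne_zero h'
  funext n
  have expand : cubeDownBeta a q (cubeUpBeta a q β) n =
      ∑ j ∈ Finset.range (n + 1), ∑ m ∈ Finset.range (j + 1),
        1 / (qPoch (a * q) q (2 * n) * q ^ (n ^ 2) * a ^ n) * (a ^ m * q ^ (m ^ 2)) *
          ((-1) ^ (n - j) * (q ^ 3) ^ ((n - j).choose 2) /
            (qPoch (q ^ 3) (q ^ 3) (n - j) * qPoch (q ^ 3) (q ^ 3) (j - m)) *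
          (qPoch (a * q) q (3 * j - m) * qPoch (a * q ^ (2 * n + 1)) q⁻¹ (3 * (n - j)))) * β m := by
    unfold cubeDownBeta cubeUpBeta
    rw [← Finset.sum_flip, Finset.mul_sum]
    refine Finset.sum_congr rfl fun j hj => ?_
    have hj' : n - (n - j) = j := Nat.sub_sub_self (Nat.lt_succ_iff.1 (Finset.mem_range.1 hj))
    rw [hj', Finset.mul_sum, Finset.mul_sum, Finset.mul_sum]
    refine Finset.sum_congr rfl fun m _ => ?_
    have hz : q ^ (3 * ((n - j).choose 2 : ℤ) - (n : ℤ) ^ 2) =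
        (q ^ 3) ^ ((n - j).choose 2) / q ^ (n ^ 2) := by
      rw [zpow_sub₀ hq, ← pow_mul]
      norm_cast
    have hz' : a ^ (-(n : ℤ)) = (a ^ n)⁻¹ := by rw [zpow_neg, zpow_natCast]
    rw [hz, hz']
    have := hQ3 (2 * j)
    field_simp
  -- A `q³`-binomial sum of length `n - m` meets a polynomial of degree below `n - m`.
  have vanish : ∀ m < n, ∑ j ∈ Finset.Ico m (n + 1),
      (-1) ^ (n - j) * (q ^ 3) ^ ((n - j).choose 2) /
        (qPoch (q ^ 3) (q ^ 3) (n - j) * qPoch (q ^ 3) (q ^ 3) (j - m)) *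
        (qPoch (a * q) q (3 * j - m) * qPoch (a * q ^ (2 * n + 1)) q⁻¹ (3 * (n - j))) = 0 := by
    intro m hm
    obtain ⟨g, hg, hgy⟩ := exists_polynomial_qPoch (a / q ^ n * q ^ 2 * (q ^ 3) ^ m) q (n - m - 1)
    have key := sum_qBinomial_eval_eq_zero (pow_ne_zero 3 hq) h (n := n - m) g (by omega)
    rw [Finset.sum_Ico_eq_sum_range, show n + 1 - m = n - m + 1 by omega,
      ← mul_zero (qPoch (a * q) q (2 * n + 1)), ← key, Finset.mul_sum]
    refine Finset.sum_congr rfl fun i hi => ?_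
    rw [Finset.mem_range] at hi
    rw [qPoch_mul_qPoch_inv_base hq a (by omega) (by omega) hm, hgy, Nat.add_sub_cancel_left,
      Nat.sub_add_eq, pow_add, mul_assoc _ ((q ^ 3) ^ m)]
    ring
  rw [expand, Finset.sum_comm' (t' := Finset.range (n + 1)) (s' := fun m => Finset.Ico m (n + 1))
    (by intro x y; simp only [Finset.mem_Ico, Finset.mem_range]; omega)]
  simp only [← Finset.sum_mul, ← Finset.mul_sum]
  rw [Finset.sum_range_succ, Finset.sum_eq_zero fun m hm => by
    rw [vanish m (Finset.mem_range.1 hm), mul_zero, zero_mul]]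
  have := hQ (2 * n)
  simp only [Nat.Ico_succ_singleton, Finset.sum_singleton, Nat.sub_self, qPoch_zero, mul_zero,
    Nat.choose_zero_succ, pow_zero, show 3 * n - n = 2 * n by omega]
  field_simp
  simp

theorem cubeDownBeta_injective {K : Type*} [Field K] {a q : K} (ha : a ≠ 0) (hq : q ≠ 0)
    (ha1 : ∀ m : ℕ, 1 ≤ m → a * q ^ m ≠ 1)
    (ha3 : ∀ m : ℕ, 1 ≤ m → a ^ 3 * (q ^ 3) ^ m ≠ 1) :
    Function.Injective (cubeDownBeta a q) := by
  intro β γ hβγ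
  funext n
  induction n using Nat.strong_induction_on with
  | _ n ih =>
    have hn := congrFun hβγ n
    unfold cubeDownBeta at hn
    have hn := mul_left_cancel₀ (one_div_ne_zero (qPoch_mul_self_ne_zero ha1 _)) hn
    -- The split-off `k = 0` term is the diagonal one; the others involve smaller indices.
    rw [Finset.sum_range_succ', Finset.sum_range_succ'] at hn
    have : ∀ k ∈ Finset.range n, β (n - (k + 1)) = γ (n - (k + 1)) := fun k hk =>
      ih _ (by rw [Finset.mem_range] at hk; omega)
    rw [Finset.sum_congr rfl fun k hk => by rw [this k hk]] at hn
    have hn := add_left_cancel hn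
    refine mul_left_cancel₀ ?_ hn
    simp only [mul_zero, qPoch_zero, tsub_zero, pow_zero, div_one, one_mul, mul_one]
    exact mul_ne_zero (mul_ne_zero (qPoch_mul_self_ne_zero ha3 _) (zpow_ne_zero _ hq))
      (zpow_ne_zero _ ha)

theorem cubeDownAlpha_cubeUpAlpha {K : Type*} [Field K] {a q : K} (ha : a ≠ 0) (hq : q ≠ 0)
    (α : ℕ → K) : cubeDownAlpha a q (cubeUpAlpha a q α) = α := by
  funext r
  simp only [cubeDownAlpha, cubeUpAlpha, zpow_neg, ← Nat.cast_pow, zpow_natCast]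
  field_simp

theorem cubeUpAlpha_cubeDownAlpha {K : Type*} [Field K] {a q : K} (ha : a ≠ 0) (hq : q ≠ 0)
    (α : ℕ → K) : cubeUpAlpha a q (cubeDownAlpha a q α) = α := by
  funext r
  simp only [cubeDownAlpha, cubeUpAlpha, zpow_neg, ← Nat.cast_pow, zpow_natCast]
  field_simp

theorem theorem2p4 {K : Type*} [Field K] (a q : K) (ha : a ≠ 0) (hq : q ≠ 0)
    (hq3 : ∀ m : ℕ, 1 ≤ m → (q ^ 3) ^ m ≠ 1)
    (haq3 : ∀ m : ℕ, 1 ≤ m → a ^ 3 * (q ^ 3) ^ m ≠ 1) :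
    (∀ α β : ℕ → K, IsBaileyPair (a ^ 3) (q ^ 3) α β →
      IsBaileyPair a q (cubeDownAlpha a q α) (cubeDownBeta a q β)) ∧
    (∀ α β : ℕ → K,
      cubeDownAlpha a q (cubeUpAlpha a q α) = α ∧
      cubeDownBeta a q (cubeUpBeta a q β) = β ∧
      cubeUpAlpha a q (cubeDownAlpha a q α) = α ∧
      cubeUpBeta a q (cubeDownBeta a q β) = β) := by
  have haq : ∀ m : ℕ, 1 ≤ m → a * q ^ m ≠ 1 := fun m hm hm1 =>
    haq3 m hm (by rw [pow_right_comm, ← mul_pow, hm1, one_pow])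
  have hdu := cubeDownBeta_cubeUpBeta ha hq hq3 haq3
  refine ⟨fun α β hαβ => ?_, fun α β => ⟨cubeDownAlpha_cubeUpAlpha ha hq α, hdu β,
    cubeUpAlpha_cubeDownAlpha ha hq α, cubeDownBeta_injective ha hq haq haq3 (hdu _)⟩⟩
  -- `γ` is the partner forced on `α'`; lifting it returns `α`, hence also `β`, so the downward map
  -- sends `β` to `γ`.
  let γ : ℕ → K := fun n => ∑ r ∈ Finset.range (n + 1),
    cubeDownAlpha a q α r / (qPoch q q (n - r) * qPoch (a * q) q (n + r))
  have hγ : IsBaileyPair a q (cubeDownAlpha a q α) γ := fun _ => rfl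
  have hup := isBaileyPair_cubeUp hq hq3 haq3 hγ
  rw [cubeUpAlpha_cubeDownAlpha ha hq] at hup
  have : cubeUpBeta a q γ = β := funext fun n => (hup n).trans (hαβ n).symm
  rwa [← this, hdu]
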